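/- Let $\Omega\subset\mathbb R^2$ be a bounded, connected open set with smooth ($C^\infty$) boundary, lying locally on one side of its boundary, and with exactly $k\ge 0$ holes, i.e. $\mathbb R^2\setminus\Omega$ has exactly $k$ bounded connected components (the holes). The boundaries of the holes are called the interior boundary components of $\Omega$. Say that a collection of $n\ge 0$ paths $\gamma_1,\dots,\gamma_n:[0,1]\to\overline\Omega$ *cuts* $\overline\Omega$ if each $\gamma_j$ is a piecewise smooth immersed line (continuous, locally injective, and smooth with non-vanishing derivative on each closed interval of some finite subdivision of $[0,1]$; self-intersections are allowed) and, with $\mathcal N=\bigcup_{j=1}^n\gamma_j([0,1])$: 1. each $\gamma_j$ starts and finishes on $\partial\Omega$ and is transversal to $\partial\Omega$ at its two end points; 2. at every intersection in $\Omega$ of two different paths $\gamma_i,\gamma_j$ ($i\ne j$), the intersection is transversal (each one-sided tangent vector of $\gamma_i$ there is linearly independent of each one-sided tangent vector of $\gamma_j$); 3. $\Omega\setminus\mathcal N$ is connected; 4. for each interior boundary component $\Sigma$, the number of indices $j$ such that $\gamma_j$ starts or finishes on $\Sigma$ is odd. If $\{\gamma_1,\dots,\gamma_n\}$ cuts $\overline\Omega$,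 where $\Omega$ has $k$ holes, then $$\frac k2\le n\le k .$$ -/

import Mathlib

open Set Topology
open scoped ContDiff

/-- The Euclidean plane. -/
abbrev Plane : Type := EuclideanSpace ℝ (Fin 2)

/-- `Ω` has smooth boundary: near each boundary point `Ω` is the negativity set of a smooth
function with non-vanishing differential at that point (so `Ω` lies on one side of its
boundary, which is a smooth curve). -/
def HasSmoothBoundary (Ω : Set Plane) : Prop :=
  ∀ p ∈ frontier Ω, ∃ (U : Set Plane) (ρ : Plane → ℝ), IsOpen U ∧ p ∈ U ∧
    ContDiffOn ℝ ∞ ρ U ∧ fderiv ℝ ρ p ≠ 0 ∧ ∀ x ∈ U, (x ∈ Ω ↔ ρ x < 0)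

/-- The holes of a planar region: the bounded connected components of its complement. The
interior boundary components of the region are the frontiers of its holes. -/
def holes (Ω : Set Plane) : Set (Set Plane) :=
  {C | Bornology.IsBounded C ∧ ∃ x ∈ Ωᶜ, C = connectedComponentIn Ωᶜ x}

/-- `Ω` is a bounded planar region with smooth boundary and exactly `k` holes. -/
structure IsRegionWithHoles (Ω : Set Plane) (k : ℕ) : Prop where
  isOpen : IsOpen Ω
  isConnected : IsConnected Ω
  isBounded : Bornology.IsBounded Ω
  smoothBoundary : HasSmoothBoundary Ω
  encard_holes : (holes Ω).encard = k

/-- `γ`, restricted to `[0, 1]`, is a piecewise smooth immersed line: it is continuous and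
locally injective on `[0, 1]`, and `[0, 1]` can be subdivided into finitely many closed intervals
on each of which `γ` is smooth (up to the end points) with nowhere vanishing derivative.
Self-intersections are allowed. Values of `γ` outside `[0, 1]` play no role. -/
structure IsPiecewiseSmoothImmersion (γ : ℝ → Plane) : Prop where
  continuousOn : ContinuousOn γ (Icc 0 1)
  locallyInjective : ∀ t ∈ Icc (0 : ℝ) 1, ∃ V ∈ 𝓝 t, InjOn γ (V ∩ Icc 0 1)
  pieces : ∃ (m : ℕ) (s : Fin (m + 1) → ℝ), StrictMono s ∧ s 0 = 0 ∧ s (Fin.last m) = 1 ∧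
    ∀ i : Fin m, ContDiffOn ℝ ∞ γ (Icc (s i.castSucc) (s i.succ)) ∧
      ∀ t ∈ Icc (s i.castSucc) (s i.succ),
        derivWithin γ (Icc (s i.castSucc) (s i.succ)) t ≠ 0

/-- The one-sided tangent vectors at time `t ∈ [0, 1]` of a path `γ` on `[0, 1]`: the right
derivative (if `t < 1`) and the left derivative (if `0 < t`). They agree away from corners. -/
def tangents (γ : ℝ → Plane) (t : ℝ) : Set Plane :=
  {v | (t < 1 ∧ HasDerivWithinAt γ v (Ici t) t) ∨ (0 < t ∧ HasDerivWithinAt γ v (Iic t) t)}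

/-- The paths `γ j`, each parametrised by `[0, 1]`, cut the closure of `Ω`. -/
structure Cuts {n : ℕ} (Ω : Set Plane) (γ : Fin n → ℝ → Plane) : Prop where
  /-- Each path is a piecewise smooth immersed line. -/
  immersed : ∀ j, IsPiecewiseSmoothImmersion (γ j)
  /-- Each path lies in the closed region. -/
  mem_closure : ∀ j, ∀ t ∈ Icc (0 : ℝ) 1, γ j t ∈ closure Ω
  /-- Each path starts at the boundary, -/
  start_mem : ∀ j, γ j 0 ∈ frontier Ω
  /-- and finishes at the boundary, -/
  finish_mem : ∀ j, γ j 1 ∈ frontier Ω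
  /-- and is transversal to the boundary where it starts (its tangent there is not tangent to
  the boundary curve), -/
  start_transversal : ∀ j, ∀ v ∈ tangents (γ j) 0, v ∉ tangentConeAt ℝ (frontier Ω) (γ j 0)
  /-- and where it finishes. -/
  finish_transversal : ∀ j, ∀ v ∈ tangents (γ j) 1, v ∉ tangentConeAt ℝ (frontier Ω) (γ j 1)
  /-- Different paths intersect transversally inside `Ω`. -/
  transversal : ∀ i j, i ≠ j → ∀ s ∈ Icc (0 : ℝ) 1, ∀ t ∈ Icc (0 : ℝ) 1,
    γ i s = γ j t → γ i s ∈ Ω →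
      ∀ v ∈ tangents (γ i) s, ∀ w ∈ tangents (γ j) t, LinearIndependent ℝ ![v, w]
  /-- The complement of the lines in `Ω` is connected. -/
  isConnected_compl : IsConnected (Ω \ ⋃ j, γ j '' Icc 0 1)
  /-- An odd number of lines leaves each interior boundary component. -/
  odd_lines : ∀ C ∈ holes Ω, Odd {j | γ j 0 ∈ frontier C ∨ γ j 1 ∈ frontier C}.ncard

/-! Lower bound: the `2 * n` line ends each lie in one component of the complement of `Ω`, and an
odd number of lines touching a hole is at least one, so every hole contains an end
(`IsRegionWithHoles.le_two_mul`).

Upper bound: cut each line off at its first return to the boundary. This gives `n` arcs in `Ω`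
joining components of `Ωᶜ`, of which there are at most `k + 1`. In the graph with these components
as vertices and the arcs as edges, a cycle would separate `Ω`; so the graph is a forest and `n < k +
1`.

The separation argument is cohomological. Take points `a`, `b` close together on the two sides of
arc `i`, near a regular point on no other arc. As the arcs do not separate `Ω`, the quotient `(z -
a) / (z - b)` has a continuous logarithm on `Ωᶜ` and all arcs
(`IsPreconnected.exists_log_sub_div_sub`). Its difference from the principal logarithm is constant
on every component and every other arc, but changes by `2πi` along arc `i` (`eventually_log_jump`).
It thus defines a function on the vertices whose coboundary is supported on edge `i`. These `n`
functions and the constant `1` are linearly independent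
(`card_arcs_lt_card_of_isPreconnected_diff`).

Self-intersections inside `Ω` are excluded by the same jump: around a loop it would have to vanish
(`Cuts.injOn_Ioo`). -/

/-! ### Continuous logarithms and winding -/

/-- A continuous function on a preconnected set all of whose values are logarithms of `1` is
constant. -/
theorem IsPreconnected.eq_of_exp_eq_one {X : Type*} [TopologicalSpace X] {S : Set X}
    (hS : IsPreconnected S) {D : X → ℂ} (hD : ContinuousOn D S)
    (h1 : ∀ x ∈ S, Complex.exp (D x) = 1) {x y : X} (hx : x ∈ S) (hy : y ∈ S) : D x = D y := by
  refine hS.induction₂ (fun x y => D x = D y) (fun x hx => ?_)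
    (fun _ _ _ _ _ _ h h' => h.trans h') (fun _ _ _ _ h => h.symm) hx hy
  -- Distinct logarithms of `1` are at least `2π` apart, so any radius up to `2π` would do.
  have hnear : ∀ᶠ y in 𝓝[S] x, dist (D y) (D x) < 1 :=
    (hD x hx) (Metric.ball_mem_nhds _ one_pos)
  filter_upwards [hnear, self_mem_nhdsWithin] with y hyx hyS
  have he : Complex.exp (D y - D x) = 1 := by rw [Complex.exp_sub, h1 y hyS, h1 x hx, div_one]
  obtain ⟨m, hm⟩ := Complex.exp_eq_one_iff.1 he
  rw [dist_eq_norm, hm] at hyx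
  have hm0 : m = 0 := by
    by_contra hne
    have h1m : (1 : ℝ) ≤ |(m : ℝ)| := by exact_mod_cast Int.one_le_abs hne
    have hn : ‖(m : ℂ) * (2 * Real.pi * Complex.I)‖ = |(m : ℝ)| * (2 * Real.pi) := by
      simp [abs_of_pos Real.pi_pos]
    rw [hn] at hyx
    nlinarith [Real.pi_gt_three]
  rw [hm0] at hm
  simp only [Int.cast_zero, zero_mul] at hm
  exact (sub_eq_zero.1 hm).symm

/-- Points of a preconnected set avoiding a closed set `K` are not separated by `K`: the quotient
`(z - a) / (z - b)` has a continuous logarithm on `K`. -/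
theorem IsPreconnected.exists_log_sub_div_sub {K S : Set ℂ} (hK : IsClosed K)
    (hS : IsPreconnected S) (hSK : Disjoint S K) {a b : ℂ} (ha : a ∈ S) (hb : b ∈ S) :
    ∃ L : ℂ → ℂ, ContinuousOn L K ∧ ∀ z ∈ K, Complex.exp (L z) = (z - a) / (z - b) := by
  have hne : ∀ x ∈ S, ∀ z ∈ K, z - x ≠ 0 := fun x hx z hz h =>
    hSK.ne_of_mem hx hz (sub_eq_zero.1 h).symm
  refine hS.induction₂ (fun a b => ∃ L : ℂ → ℂ, ContinuousOn L K ∧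
    ∀ z ∈ K, Complex.exp (L z) = (z - a) / (z - b)) (fun x hx => ?_) ?_ ?_ ha hb
  · have hxK : Kᶜ ∈ 𝓝 x := hK.isOpen_compl.mem_nhds (hSK.notMem_of_mem_left hx)
    obtain ⟨r, hr, hball⟩ := Metric.mem_nhds_iff.1 hxK
    have hev : ∀ᶠ y in 𝓝[S] x, y ∈ Metric.ball x r :=
      nhdsWithin_le_nhds (Metric.ball_mem_nhds _ hr)
    filter_upwards [hev, self_mem_nhdsWithin] with y hy hyS
    have hmem : ∀ z ∈ K, (z - y) / (z - x) ∈ Complex.slitPlane := by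
      intro z hz
      have hzr : r ≤ ‖z - x‖ := by
        by_contra! h
        exact hball (by simpa [dist_eq_norm] using h) hz
      have hzx := hne x hx z hz
      -- For `y` closer to `x` than `K` is, the quotient stays in the unit disc about `1`, where the
      -- principal logarithm is continuous.
      have e : (z - y) / (z - x) = 1 + (x - y) / (z - x) := by field_simp; ring
      rw [e]
      apply Complex.mem_slitPlane_of_norm_lt_one
      rw [norm_div, div_lt_one (norm_pos_iff.2 hzx)]
      rw [Metric.mem_ball, dist_comm, dist_eq_norm] at hy
      linarith
    refine ⟨fun z => -Complex.log ((z - y) / (z - x)), ?_, fun z hz => ?_⟩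
    · refine (ContinuousOn.clog ?_ hmem).neg
      exact (by fun_prop : ContinuousOn (fun z => z - y) K).div (by fun_prop) (hne x hx)
    · rw [Complex.exp_neg, Complex.exp_log (div_ne_zero (hne y hyS z hz) (hne x hx z hz)), inv_div]
  · rintro x y z hx hy hz ⟨L, hL, hL'⟩ ⟨M, hM, hM'⟩
    refine ⟨fun t => L t + M t, hL.add hM, fun t ht => ?_⟩
    rw [Complex.exp_add, hL' t ht, hM' t ht, div_mul_div_cancel₀ (hne y hy t ht)]
  · rintro x y hx hy ⟨L, hL, hL'⟩
    refine ⟨fun t => -L t, hL.neg, fun t ht => ?_⟩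
    rw [Complex.exp_neg, hL' t ht, inv_div]

/-- With the imaginary part below, this locates the branch cut: for `ε > 0` the quotient is a
nonpositive real only if `g` is on the segment from `-εi` to `εi`. -/
theorem Complex.re_sub_div_add (g : ℂ) (ε : ℝ) :
    ((g - ε * I) / (g + ε * I)).re = (normSq g - ε ^ 2) / normSq (g + ε * I) := by
  rw [div_re, normSq_apply g]
  simp
  ring

theorem Complex.im_sub_div_add (g : ℂ) (ε : ℝ) :
    ((g - ε * I) / (g + ε * I)).im = -(2 * ε * g.re) / normSq (g + ε * I) := by
  rw [div_im]
  simp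
  ring

/-- The quotient `(g - εi) / (g + εi)` is off the branch cut when `g` is off the segment between
`εi` and `-εi`: the case of large `g`. -/
theorem Complex.sub_div_add_mem_slitPlane {g : ℂ} {ε : ℝ} (hε : 0 < ε) (hg : ε < ‖g‖) :
    g - ε * I ≠ 0 ∧ g + ε * I ≠ 0 ∧ (g - ε * I) / (g + ε * I) ∈ slitPlane := by
  have hn : ‖(ε : ℂ) * I‖ = ε := by simp [abs_of_pos hε]
  have h1 : g - ε * I ≠ 0 := fun h => by
    rw [sub_eq_zero.1 h, hn] at hg; exact lt_irrefl _ hg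
  have h2 : g + ε * I ≠ 0 := fun h => by
    rw [eq_neg_of_add_eq_zero_left h, norm_neg, hn] at hg; exact lt_irrefl _ hg
  refine ⟨h1, h2, Or.inl ?_⟩
  rw [re_sub_div_add, normSq_eq_norm_sq g]
  exact div_pos (by nlinarith) (normSq_pos.2 h2)

/-- A path crossing the segment between `εi` and `-εi` once, at the origin: any continuous
logarithm of `(g - εi) / (g + εi)` along it differs from the principal one by a jump `2πi`. -/
theorem log_jump_of_re_sign {g L : ℝ → ℂ} {u τ v ε : ℝ} (hε : 0 < ε)
    (hg : ContinuousOn g (Icc u v)) (huτ : u < τ) (hτv : τ < v) (h0 : g τ = 0)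
    (hneg : ∀ᶠ t in 𝓝[<] τ, (g t).re < 0) (hpos : ∀ᶠ t in 𝓝[>] τ, 0 < (g t).re)
    (hslit : ∀ t ∈ Icc u v, t ≠ τ → g t + ε * Complex.I ≠ 0 ∧
      (g t - ε * Complex.I) / (g t + ε * Complex.I) ∈ Complex.slitPlane)
    (hL : ContinuousOn L (Icc u v))
    (hexp : ∀ t ∈ Icc u v,
      Complex.exp (L t) = (g t - ε * Complex.I) / (g t + ε * Complex.I)) :
    (L v - Complex.log ((g v - ε * Complex.I) / (g v + ε * Complex.I))) -
      (L u - Complex.log ((g u - ε * Complex.I) / (g u + ε * Complex.I))) =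
      2 * Real.pi * Complex.I := by
  set f : ℝ → ℂ := fun t => (g t - ε * Complex.I) / (g t + ε * Complex.I) with hf
  have hεI : (ε : ℂ) * Complex.I ≠ 0 := by simp [hε.ne']
  have hden : ∀ t ∈ Icc u v, g t + ε * Complex.I ≠ 0 := by
    intro t ht
    by_cases h : t = τ
    · rw [h, h0, zero_add]; exact hεI
    · exact (hslit t ht h).1
  have hfc : ContinuousOn f (Icc u v) :=
    (hg.sub continuousOn_const).div (hg.add continuousOn_const) hden
  have hfτ : f τ = -1 := by
    simp only [hf, h0, zero_sub, zero_add]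
    rw [neg_div, div_self hεI]
  set D : ℝ → ℂ := fun t => L t - Complex.log (f t) with hDdef
  have hDc : ∀ P ⊆ Icc u v, τ ∉ P → IsPreconnected P →
      ∀ x ∈ P, ∀ y ∈ P, D x = D y := by
    intro P hP hτP hPc x hx y hy
    have hs : ∀ t ∈ P, f t ∈ Complex.slitPlane := fun t ht =>
      (hslit t (hP ht) (fun h => hτP (h ▸ ht))).2
    refine hPc.eq_of_exp_eq_one ((hL.mono hP).sub ((hfc.mono hP).clog hs)) (fun t ht => ?_) hx hy
    have hne := Complex.slitPlane_ne_zero (hs t ht)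
    change Complex.exp (L t - Complex.log (f t)) = 1
    rw [Complex.exp_sub, Complex.exp_log hne, hexp t (hP ht)]
    exact div_self hne
  have hτm : τ ∈ Icc u v := ⟨huτ.le, hτv.le⟩
  have hnhds : Icc u v ∈ 𝓝 τ := Icc_mem_nhds huτ hτv
  have hLτ : ContinuousAt L τ := hL.continuousAt hnhds
  have hfτc : ContinuousAt f τ := hfc.continuousAt hnhds
  have hft : ∀ (s : Set ℝ), Filter.Tendsto f (𝓝[s] τ) (𝓝 (-1)) := fun s =>
    hfτ ▸ hfτc.tendsto.mono_left nhdsWithin_le_nhds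
  -- The imaginary part of `f` has the sign of `-(g t).re`, so `f` reaches `-1` from above the cut
  -- before `τ` and leaves it below: the limits are `πi` and `-πi`.
  have hl : Filter.Tendsto (fun t => Complex.log (f t)) (𝓝[<] τ) (𝓝 (Real.pi * Complex.I)) := by
    have := Complex.tendsto_log_nhdsWithin_im_nonneg_of_re_neg_of_im_zero
      (z := -1) (by simp) (by simp)
    simp only [norm_neg, norm_one, Real.log_one, Complex.ofReal_zero, zero_add] at this
    refine this.comp (tendsto_nhdsWithin_iff.2 ⟨hft _, ?_⟩)
    filter_upwards [hneg] with t ht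
    rw [hf, Complex.im_sub_div_add]
    exact div_nonneg (by nlinarith) (Complex.normSq_nonneg _)
  have hr : Filter.Tendsto (fun t => Complex.log (f t)) (𝓝[>] τ)
      (𝓝 (-(Real.pi * Complex.I))) := by
    have := Complex.tendsto_log_nhdsWithin_im_neg_of_re_neg_of_im_zero
      (z := -1) (by simp) (by simp)
    simp only [norm_neg, norm_one, Real.log_one, Complex.ofReal_zero, zero_sub] at this
    refine this.comp (tendsto_nhdsWithin_iff.2 ⟨hft _, ?_⟩)
    filter_upwards [hpos, Ioo_mem_nhdsGT hτv] with t ht htI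
    rw [hf, Complex.im_sub_div_add]
    exact div_neg_of_neg_of_pos (by nlinarith)
      (Complex.normSq_pos.2 (hden t ⟨huτ.le.trans htI.1.le, htI.2.le⟩))
  have hDu : D u = L τ - Real.pi * Complex.I := by
    have h1 : Filter.Tendsto D (𝓝[<] τ) (𝓝 (L τ - Real.pi * Complex.I)) :=
      (hLτ.tendsto.mono_left nhdsWithin_le_nhds).sub hl
    refine tendsto_nhds_unique (tendsto_const_nhds.congr' ?_) h1
    filter_upwards [Ioo_mem_nhdsLT huτ] with t ht
    exact hDc (Ico u τ) (fun x hx => ⟨hx.1, hx.2.le.trans hτv.le⟩) (by simp) isPreconnected_Ico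
      u ⟨le_rfl, huτ⟩ t ⟨ht.1.le, ht.2⟩
  have hDv : D v = L τ - -(Real.pi * Complex.I) := by
    have h1 : Filter.Tendsto D (𝓝[>] τ) (𝓝 (L τ - -(Real.pi * Complex.I))) :=
      (hLτ.tendsto.mono_left nhdsWithin_le_nhds).sub hr
    refine tendsto_nhds_unique (tendsto_const_nhds.congr' ?_) h1
    filter_upwards [Ioo_mem_nhdsGT hτv] with t ht
    exact hDc (Ioc τ v) (fun x hx => ⟨huτ.le.trans hx.1.le, hx.2⟩) (by simp) isPreconnected_Ioc
      v ⟨hτv, le_rfl⟩ t ⟨ht.1, ht.2.le⟩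
  change D v - D u = _
  rw [hDu, hDv]
  ring

/-- The crossing lemma. If a path passes through a point with non-zero velocity `w` and meets that
point only once, then short segments orthogonal to `w` are crossed exactly once, and the
logarithm of the quotient of the distances to their end points jumps there by `2πi`. -/
theorem eventually_log_jump {α : ℝ → ℂ} {u τ v : ℝ} {w : ℂ} (hα : ContinuousOn α (Icc u v))
    (huτ : u < τ) (hτv : τ < v) (hd : HasDerivAt α w τ) (hw : w ≠ 0)
    (hinj : ∀ t ∈ Icc u v, α t = α τ → t = τ) :
    ∀ᶠ ε : ℝ in 𝓝[>] 0,
      (∀ t ∈ Icc u v, α t ≠ α τ + ε * Complex.I * w ∧ α t ≠ α τ - ε * Complex.I * w) ∧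
      ∀ L : ℝ → ℂ, ContinuousOn L (Icc u v) →
        (∀ t ∈ Icc u v, Complex.exp (L t) =
          (α t - (α τ + ε * Complex.I * w)) / (α t - (α τ - ε * Complex.I * w))) →
        (L v - Complex.log
            ((α v - (α τ + ε * Complex.I * w)) / (α v - (α τ - ε * Complex.I * w)))) -
          (L u - Complex.log
            ((α u - (α τ + ε * Complex.I * w)) / (α u - (α τ - ε * Complex.I * w)))) =
          2 * Real.pi * Complex.I := by
  -- Normalised to pass through the origin with velocity `1`, so that the real part changes sign at
  -- `τ`.
  set g : ℝ → ℂ := fun t => (α t - α τ) / w with hgdef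
  have hg : ContinuousOn g (Icc u v) := (hα.sub continuousOn_const).div_const _
  have h0 : g τ = 0 := by simp [hgdef]
  have hgd : HasDerivAt g 1 τ := by
    have := (hd.sub_const (α τ)).div_const w
    rwa [div_self hw] at this
  have hre : HasDerivAt (fun t => (g t).re) 1 τ := by
    have h := Complex.reCLM.hasFDerivAt.comp_hasDerivAt τ hgd
    rw [Complex.reCLM_apply, Complex.one_re] at h
    exact h
  have hre0 : (g τ).re = 0 := by simp [h0]
  have hsl := hasDerivAt_iff_tendsto_slope.1 hre
  have hslpos : ∀ᶠ t in 𝓝[≠] τ, 0 < slope (fun t => (g t).re) τ t :=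
    hsl.eventually (lt_mem_nhds one_pos)
  have hsign : ∀ᶠ t in 𝓝[≠] τ, 0 < (g t).re / (t - τ) := by
    filter_upwards [hslpos] with t ht
    rwa [slope_def_field, hre0, sub_zero] at ht
  have hneg : ∀ᶠ t in 𝓝[<] τ, (g t).re < 0 := by
    filter_upwards [hsign.filter_mono (nhdsWithin_mono _ fun x hx => ne_of_lt hx),
      self_mem_nhdsWithin] with t ht htτ
    by_contra! h
    exact absurd ht (not_lt.2 (div_nonpos_of_nonneg_of_nonpos h (sub_nonpos.2 (le_of_lt htτ))))
  have hpos : ∀ᶠ t in 𝓝[>] τ, 0 < (g t).re := by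
    filter_upwards [hsign.filter_mono (nhdsWithin_mono _ fun x hx => ne_of_gt hx),
      self_mem_nhdsWithin] with t ht htτ
    by_contra! h
    exact absurd ht (not_lt.2 (div_nonpos_of_nonpos_of_nonneg h (sub_nonneg.2 (le_of_lt htτ))))
  have hre_ne : ∀ᶠ t in 𝓝 τ, t ≠ τ → (g t).re ≠ 0 := by
    have : ∀ᶠ t in 𝓝[≠] τ, (g t).re ≠ 0 := by
      filter_upwards [hsign] with t ht h
      simp [h] at ht
    exact eventually_nhdsWithin_iff.1 this
  obtain ⟨δ, hδ, hδ'⟩ := Metric.eventually_nhds_iff.1 hre_ne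
  -- Near `τ` the nonzero real part keeps `g` off the segment; elsewhere compactness bounds `g` away
  -- from `0`, and `ε` is taken below that bound.
  have hcpt : IsCompact (Icc u v \ Metric.ball τ δ) := isCompact_Icc.diff Metric.isOpen_ball
  obtain ⟨m, hm, hm'⟩ : ∃ m > 0, ∀ t ∈ Icc u v \ Metric.ball τ δ, m < ‖g t‖ := by
    rcases (Icc u v \ Metric.ball τ δ).eq_empty_or_nonempty with he | hne
    · exact ⟨1, one_pos, by simp [he]⟩
    · obtain ⟨t₀, ht₀, hmin⟩ := hcpt.exists_isMinOn hne (hg.mono sdiff_subset).norm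
      have hpos₀ : 0 < ‖g t₀‖ := by
        rw [norm_pos_iff]
        intro h
        rw [hgdef] at h
        simp only [div_eq_zero_iff, hw, or_false, sub_eq_zero] at h
        exact ht₀.2 ((hinj t₀ ht₀.1 h).symm ▸ Metric.mem_ball_self hδ)
      exact ⟨‖g t₀‖ / 2, by positivity, fun t ht =>
        (half_lt_self hpos₀).trans_le (hmin ht)⟩
  filter_upwards [Ioo_mem_nhdsGT hm] with ε hε
  have hε0 : 0 < ε := hε.1
  have hslit : ∀ t ∈ Icc u v, t ≠ τ → g t - ε * Complex.I ≠ 0 ∧ g t + ε * Complex.I ≠ 0 ∧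
      (g t - ε * Complex.I) / (g t + ε * Complex.I) ∈ Complex.slitPlane := by
    intro t ht htτ
    by_cases hb : t ∈ Metric.ball τ δ
    · have hr := hδ' hb htτ
      have h1 : g t - ε * Complex.I ≠ 0 := fun h => hr (by simpa using congrArg Complex.re h)
      have h2 : g t + ε * Complex.I ≠ 0 := fun h => hr (by simpa using congrArg Complex.re h)
      refine ⟨h1, h2, Or.inr ?_⟩
      rw [Complex.im_sub_div_add]
      exact div_ne_zero (neg_ne_zero.2 (mul_ne_zero (by positivity) hr))
        (Complex.normSq_pos.2 h2).ne'
    · exact Complex.sub_div_add_mem_slitPlane hε0 (hε.2.trans (hm' t ⟨ht, hb⟩))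
  have hεI : (ε : ℂ) * Complex.I ≠ 0 := by simp [hε0.ne']
  have e1 : ∀ t, α t - (α τ + ε * Complex.I * w) = w * (g t - ε * Complex.I) := by
    intro t; simp only [hgdef]; field_simp; ring
  have e2 : ∀ t, α t - (α τ - ε * Complex.I * w) = w * (g t + ε * Complex.I) := by
    intro t; simp only [hgdef]; field_simp; ring
  have e3 : ∀ t, (α t - (α τ + ε * Complex.I * w)) / (α t - (α τ - ε * Complex.I * w)) =
      (g t - ε * Complex.I) / (g t + ε * Complex.I) := by
    intro t; rw [e1, e2, mul_div_mul_left _ _ hw]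
  refine ⟨fun t ht => ?_, fun L hL hexp => ?_⟩
  · rw [ne_eq, ne_eq, ← sub_eq_zero, ← sub_eq_zero (b := α τ - _), e1, e2]
    by_cases h : t = τ
    · rw [h, h0, zero_sub, zero_add]
      exact ⟨mul_ne_zero hw (neg_ne_zero.2 hεI), mul_ne_zero hw hεI⟩
    · exact ⟨mul_ne_zero hw (hslit t ht h).1, mul_ne_zero hw (hslit t ht h).2.1⟩
  · simp only [e3] at hexp ⊢
    exact log_jump_of_re_sign hε0 hg huτ hτv h0 hneg hpos (fun t ht h => (hslit t ht h).2) hL hexp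

/-- Off the ball centred at the midpoint of a short segment, the quotient `(z - a) / (z - b)` of
the distances to its end points stays off the branch cut of the logarithm. -/
theorem sub_div_sub_mem_slitPlane {z p w : ℂ} {ε : ℝ} (hε : 0 < ε) (hw : w ≠ 0)
    (hz : ε * ‖w‖ < ‖z - p‖) :
    z - (p - ε * Complex.I * w) ≠ 0 ∧
      (z - (p + ε * Complex.I * w)) / (z - (p - ε * Complex.I * w)) ∈ Complex.slitPlane := by
  have hg : ε < ‖(z - p) / w‖ := by rwa [norm_div, lt_div_iff₀ (norm_pos_iff.2 hw)]
  obtain ⟨-, h2, h3⟩ := Complex.sub_div_add_mem_slitPlane hε hg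
  have e1 : z - (p + ε * Complex.I * w) = w * ((z - p) / w - ε * Complex.I) := by
    field_simp; ring
  have e2 : z - (p - ε * Complex.I * w) = w * ((z - p) / w + ε * Complex.I) := by
    field_simp; ring
  rw [e1, e2, mul_div_mul_left _ _ hw]
  exact ⟨mul_ne_zero hw h2, h3⟩

/-- A loop in an open set that passes through one of its regular points only once separates the
open set. -/
theorem not_isPreconnected_diff_loop {α : ℝ → ℂ} {u τ v : ℝ} {w : ℂ} {Ω : Set ℂ}
    (hΩ : IsOpen Ω) (hα : ContinuousOn α (Icc u v)) (hαΩ : ∀ t ∈ Icc u v, α t ∈ Ω)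
    (huτ : u < τ) (hτv : τ < v)
    (hd : HasDerivAt α w τ) (hw : w ≠ 0) (hinj : ∀ t ∈ Icc u v, α t = α τ → t = τ)
    (hloop : α u = α v) : ¬ IsPreconnected (Ω \ α '' Icc u v) := by
  intro hconn
  obtain ⟨r, hr, hball⟩ := Metric.isOpen_iff.1 hΩ _ (hαΩ τ ⟨huτ.le, hτv.le⟩)
  have hev : ∀ᶠ ε : ℝ in 𝓝[>] 0, ε ∈ Ioo 0 (r / ‖w‖) :=
    Ioo_mem_nhdsGT (div_pos hr (norm_pos_iff.2 hw))
  obtain ⟨ε, ⟨hε1, hε2⟩, hε⟩ := ((eventually_log_jump hα huτ hτv hd hw hinj).and hev).exists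
  have hεr : ε * ‖w‖ < r := (lt_div_iff₀ (norm_pos_iff.2 hw)).1 hε.2
  have hn : ‖(ε : ℂ) * Complex.I * w‖ = ε * ‖w‖ := by simp [abs_of_pos hε.1]
  have ha : α τ + ε * Complex.I * w ∈ Ω \ α '' Icc u v := by
    refine ⟨hball ?_, ?_⟩
    · rw [Metric.mem_ball, dist_eq_norm, add_sub_cancel_left, hn]; exact hεr
    · rintro ⟨t, ht, h⟩
      exact (hε1 t ht).1 h
  have hb : α τ - ε * Complex.I * w ∈ Ω \ α '' Icc u v := by
    refine ⟨hball ?_, ?_⟩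
    · rw [Metric.mem_ball, dist_eq_norm, sub_sub_cancel_left, norm_neg, hn]; exact hεr
    · rintro ⟨t, ht, h⟩
      exact (hε1 t ht).2 h
  obtain ⟨L, hL, hexp⟩ := IsPreconnected.exists_log_sub_div_sub
    (isCompact_Icc.image_of_continuousOn hα).isClosed hconn disjoint_sdiff_left ha hb
  have := hε2 (fun t => L (α t)) (hL.comp hα (mapsTo_image α _))
    (fun t ht => hexp _ (mem_image_of_mem α ht))
  rw [hloop, sub_self] at this
  exact Complex.two_pi_I_ne_zero this.symm

/-- A family of arcs in an open set `Ω`, joining preconnected parts `X v` of the complement, which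
together do not separate `Ω`, is smaller than the number of the parts it joins. -/
theorem card_arcs_lt_card_of_isPreconnected_diff {n : ℕ} {V : Type*} [Fintype V] [Nonempty V]
    {Ω : Set ℂ}
    (hΩ : IsOpen Ω) (X : V → Set ℂ) (hX : ∀ x, IsPreconnected (X x)) (hXΩ : ∀ x, X x ⊆ Ωᶜ)
    (α : Fin n → ℝ → ℂ) (l : Fin n → ℝ) (hα : ∀ i, ContinuousOn (α i) (Icc 0 (l i)))
    (s t : Fin n → V) (hs : ∀ i, α i 0 ∈ X (s i)) (ht : ∀ i, α i (l i) ∈ X (t i))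
    (hin : ∀ i, ∀ x ∈ Ioo 0 (l i), α i x ∈ Ω) (hinj : ∀ i, InjOn (α i) (Ioo 0 (l i)))
    (hreg : ∀ i, ∃ τ ∈ Ioo 0 (l i), (∃ w ≠ 0, HasDerivAt (α i) w τ) ∧
      ∀ j ≠ i, ∀ x ∈ Icc 0 (l j), α j x ≠ α i τ)
    (hconn : IsPreconnected (Ω \ ⋃ i, α i '' Icc 0 (l i))) : n < Fintype.card V := by
  have hcocycle : ∀ i, ∃ c : V → ℂ, ∀ j,
      c (t j) - c (s j) = if j = i then 2 * Real.pi * Complex.I else 0 := by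
    intro i
    obtain ⟨τ, hτ, ⟨w, hw, hd⟩, hav⟩ := hreg i
    have himg : ∀ j, IsClosed (α j '' Icc 0 (l j)) := fun j =>
      (isCompact_Icc.image_of_continuousOn (hα j)).isClosed
    -- The ends lie outside `Ω`, so injectivity on the open interval suffices.
    have hinjτ : ∀ x ∈ Icc 0 (l i), α i x = α i τ → x = τ := by
      intro x hx hxτ
      rcases eq_or_lt_of_le hx.1 with h0 | h0
      · exact absurd (hin i τ hτ) (hXΩ _ (by rw [← hxτ, ← h0]; exact hs i))
      rcases eq_or_lt_of_le hx.2 with h1 | h1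
      · exact absurd (hin i τ hτ) (hXΩ _ (by rw [← hxτ, h1]; exact ht i))
      exact hinj i ⟨h0, h1⟩ hτ hxτ
    have hU : IsOpen (Ω \ ⋃ j ∈ ({i}ᶜ : Set (Fin n)), α j '' Icc 0 (l j)) :=
      hΩ.sdiff ((toFinite _).isClosed_biUnion fun j _ => himg j)
    have hpU : α i τ ∈ Ω \ ⋃ j ∈ ({i}ᶜ : Set (Fin n)), α j '' Icc 0 (l j) := by
      refine ⟨hin i τ hτ, fun h => ?_⟩
      obtain ⟨j, hj, x, hx, hxe⟩ := mem_iUnion₂.1 h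
      exact hav j hj x hx hxe
    obtain ⟨r, hr, hball⟩ := Metric.isOpen_iff.1 hU _ hpU
    have hev : ∀ᶠ ε : ℝ in 𝓝[>] 0, ε ∈ Ioo 0 (r / ‖w‖) :=
      Ioo_mem_nhdsGT (div_pos hr (norm_pos_iff.2 hw))
    obtain ⟨ε, ⟨hε1, hε2⟩, hε⟩ :=
      ((eventually_log_jump (hα i) hτ.1 hτ.2 hd hw hinjτ).and hev).exists
    have hεr : ε * ‖w‖ < r := (lt_div_iff₀ (norm_pos_iff.2 hw)).1 hε.2
    have hn : ‖(ε : ℂ) * Complex.I * w‖ = ε * ‖w‖ := by simp [abs_of_pos hε.1]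
    have hoff : ∀ z ∈ Metric.ball (α i τ) r, z ∉ α i '' Icc 0 (l i) →
        z ∈ Ω \ ⋃ i, α i '' Icc 0 (l i) := by
      intro z hz hzi
      refine ⟨(hball hz).1, fun h => ?_⟩
      obtain ⟨j, hj⟩ := mem_iUnion.1 h
      by_cases hji : j = i
      · exact hzi (hji ▸ hj)
      · exact (hball hz).2 (mem_iUnion₂.2 ⟨j, hji, hj⟩)
    have ha : α i τ + ε * Complex.I * w ∈ Ω \ ⋃ i, α i '' Icc 0 (l i) := by
      refine hoff _ ?_ ?_
      · rw [Metric.mem_ball, dist_eq_norm, add_sub_cancel_left, hn]; exact hεr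
      · rintro ⟨t, ht, h⟩
        exact (hε1 t ht).1 h
    have hb : α i τ - ε * Complex.I * w ∈ Ω \ ⋃ i, α i '' Icc 0 (l i) := by
      refine hoff _ ?_ ?_
      · rw [Metric.mem_ball, dist_eq_norm, sub_sub_cancel_left, norm_neg, hn]; exact hεr
      · rintro ⟨t, ht, h⟩
        exact (hε1 t ht).2 h
    have hK : IsClosed (Ωᶜ ∪ ⋃ i, α i '' Icc 0 (l i)) :=
      hΩ.isClosed_compl.union (isClosed_iUnion_of_finite himg)
    obtain ⟨L, hL, hexp⟩ := IsPreconnected.exists_log_sub_div_sub hK hconn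
      (disjoint_left.2 fun z hz hz' => hz'.elim (fun h => h hz.1) hz.2) ha hb
    set f : ℂ → ℂ := fun z =>
      (z - (α i τ + ε * Complex.I * w)) / (z - (α i τ - ε * Complex.I * w)) with hf
    set D : ℂ → ℂ := fun z => L z - Complex.log (f z) with hD
    have hconst : ∀ P : Set ℂ, IsPreconnected P → P ⊆ Ωᶜ ∪ ⋃ i, α i '' Icc 0 (l i) →
        Disjoint P (Metric.ball (α i τ) r) → ∀ x ∈ P, ∀ y ∈ P, D x = D y := by
      intro P hP hPK hPb x hx y hy
      have hslit : ∀ z ∈ P, z - (α i τ - ε * Complex.I * w) ≠ 0 ∧ f z ∈ Complex.slitPlane := by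
        intro z hz
        refine sub_div_sub_mem_slitPlane hε.1 hw (hεr.trans_le ?_)
        have := hPb.notMem_of_mem_left hz
        rwa [Metric.mem_ball, dist_eq_norm, not_lt] at this
      have hfc : ContinuousOn f P :=
        ContinuousOn.div (by fun_prop) (by fun_prop) fun z hz => (hslit z hz).1
      refine hP.eq_of_exp_eq_one ((hL.mono hPK).sub (hfc.clog fun z hz => (hslit z hz).2))
        (fun z hz => ?_) hx hy
      have hne := Complex.slitPlane_ne_zero (hslit z hz).2
      change Complex.exp (L z - Complex.log (f z)) = 1
      rw [Complex.exp_sub, Complex.exp_log hne, hexp z (hPK hz)]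
      exact div_self hne
    have hXb : ∀ x, Disjoint (X x) (Metric.ball (α i τ) r) := fun x =>
      disjoint_left.2 fun z hz hz' => hXΩ x hz (hball hz').1
    classical
    -- `D` is constant on each part. The value `0` on an empty part is immaterial, since no arc ends
    -- there.
    refine ⟨fun x => if h : (X x).Nonempty then D h.some else 0, fun j => ?_⟩
    have hc : ∀ x, ∀ z ∈ X x, (if h : (X x).Nonempty then D h.some else 0) = D z := by
      intro x z hz
      have h : (X x).Nonempty := ⟨z, hz⟩
      rw [dif_pos h]
      exact hconst (X x) (hX x) ((hXΩ x).trans subset_union_left) (hXb x) _ h.some_mem _ hz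
    beta_reduce
    rw [hc _ _ (hs j), hc _ _ (ht j)]
    have hl : ∀ j, 0 ≤ l j := fun j => by
      obtain ⟨x, hx, -⟩ := hreg j
      exact (hx.1.trans hx.2).le
    have hsub : ∀ j, α j '' Icc 0 (l j) ⊆ Ωᶜ ∪ ⋃ i, α i '' Icc 0 (l i) := fun j =>
      (subset_iUnion (fun i => α i '' Icc 0 (l i)) j).trans subset_union_right
    split_ifs with hji
    · subst hji
      exact hε2 (fun x => L (α j x))
        (hL.comp (hα j) ((mapsTo_image _ _).mono_right (hsub j)))
        (fun x hx => hexp _ (hsub j (mem_image_of_mem _ hx)))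
    · rw [sub_eq_zero]
      refine hconst (α j '' Icc 0 (l j)) (isPreconnected_Icc.image _ (hα j)) (hsub j) ?_ _
        (mem_image_of_mem _ ⟨hl j, le_rfl⟩) _ (mem_image_of_mem _ ⟨le_rfl, hl j⟩)
      exact disjoint_left.2 fun z hz hz' => (hball hz').2 (mem_iUnion₂.2 ⟨j, hji, hz⟩)
  choose c hc using hcocycle
  have hli : LinearIndependent ℂ (fun o : Option (Fin n) => o.elim (1 : V → ℂ) c) := by
    rw [Fintype.linearIndependent_iff]
    intro g hg
    have hx : ∀ x, g none + ∑ i, g (some i) * c i x = 0 := by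
      intro x
      have := congrFun hg x
      simpa [Fintype.sum_option] using this
    -- Subtracting the relation at the two ends of arc `j` leaves only the term of `c j`.
    have hsome : ∀ j, g (some j) = 0 := by
      intro j
      have h1 := hx (t j)
      have h2 := hx (s j)
      have h3 : ∑ i, g (some i) * (c i (t j) - c i (s j)) = 0 := by
        simp only [mul_sub, Finset.sum_sub_distrib]
        linear_combination h1 - h2
      simp only [hc, mul_ite, mul_zero, Finset.sum_ite_eq, Finset.mem_univ, if_true] at h3
      exact (mul_eq_zero.1 h3).resolve_right Complex.two_pi_I_ne_zero
    intro o
    cases o with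
    | none => simpa [hsome] using hx (Classical.arbitrary V)
    | some j => exact hsome j
  have := hli.fintype_card_le_finrank
  rw [Fintype.card_option, Fintype.card_fin, Module.finrank_fintype_fun_eq_card] at this
  exact this

/-! ### Paths in the plane -/

/-- A locally injective closed path contains a simple loop. -/
theorem exists_simple_loop {E : Type*} [TopologicalSpace E] [T2Space E] {α : ℝ → E} {s t : ℝ}
    (hst : s < t) (hα : ContinuousOn α (Icc s t)) (hloop : α s = α t)
    (hinj : ∀ x ∈ Icc s t, ∃ V ∈ 𝓝 x, InjOn α (V ∩ Icc s t)) :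
    ∃ u v, s ≤ u ∧ u < v ∧ v ≤ t ∧ α u = α v ∧
      ∀ x ∈ Icc u v, ∀ y ∈ Icc u v, x < y → α x = α y → x = u ∧ y = v := by
  set B : Set (ℝ × ℝ) := Icc s t ×ˢ Icc s t with hB
  -- By local injectivity `O` contains the diagonal of `B`. Removing it leaves a compact set of
  -- coincidences, and a shortest one bounds a simple loop.
  set O : Set (ℝ × ℝ) := interior {q | q ∈ B → α q.1 = α q.2 → q.1 = q.2} with hO
  have hBc : IsCompact B := isCompact_Icc.prod isCompact_Icc
  have hF : ContinuousOn (fun q : ℝ × ℝ => (α q.1, α q.2)) B :=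
    (hα.comp continuousOn_fst fun q hq => hq.1).prodMk
      (hα.comp continuousOn_snd fun q hq => hq.2)
  set C : Set (ℝ × ℝ) := ((B ∩ (fun q : ℝ × ℝ => (α q.1, α q.2)) ⁻¹' diagonal E) ∩
    {q | q.1 ≤ q.2}) ∩ Oᶜ with hC
  have hCc : IsCompact C := by
    refine hBc.of_isClosed_subset ?_ fun q hq => hq.1.1.1
    exact ((hF.preimage_isClosed_of_isClosed hBc.isClosed isClosed_diagonal).inter
      (isClosed_le continuous_fst continuous_snd)).inter isOpen_interior.isClosed_compl
  have hmem : ∀ x ∈ Icc s t, ∀ y ∈ Icc s t, x < y → α x = α y → (x, y) ∈ C := by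
    intro x hx y hy hxy he
    refine ⟨⟨⟨⟨hx, hy⟩, he⟩, hxy.le⟩, fun h => ?_⟩
    exact hxy.ne (interior_subset h ⟨hx, hy⟩ he)
  obtain ⟨⟨u, v⟩, hq, hmin⟩ := hCc.exists_isMinOn
    ⟨(s, t), hmem s ⟨le_rfl, hst.le⟩ t ⟨hst.le, le_rfl⟩ hst hloop⟩
    (f := fun q : ℝ × ℝ => q.2 - q.1) (by fun_prop)
  obtain ⟨⟨⟨⟨hu, hv⟩, he⟩, hle⟩, hnO⟩ := hq
  have huv : u < v := by
    refine lt_of_le_of_ne hle fun h => hnO ?_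
    subst h
    obtain ⟨V, hV, hVi⟩ := hinj u hu
    refine mem_interior_iff_mem_nhds.2 (Filter.mem_of_superset (prod_mem_nhds hV hV) ?_)
    exact fun q hqV hqB heq => hVi ⟨hqV.1, hqB.1⟩ ⟨hqV.2, hqB.2⟩ heq
  refine ⟨u, v, hu.1, huv, hv.2, he, fun x hx y hy hxy hexy => ?_⟩
  have h : v - u ≤ y - x := hmin (hmem x ⟨hu.1.trans hx.1, hx.2.trans hv.2⟩ y
    ⟨hu.1.trans hy.1, hy.2.trans hv.2⟩ hxy hexy)
  constructor <;> linarith [hx.1, hy.2]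

/-! ### Piecewise smooth immersed lines: derivatives and dimension -/

namespace IsPiecewiseSmoothImmersion

variable {γ : ℝ → Plane}

theorem exists_piece_right {m : ℕ} {s : Fin (m + 1) → ℝ} (h0 : s 0 = 0) (h1 : s (Fin.last m) = 1)
    {t : ℝ} (ht : t ∈ Ico (0 : ℝ) 1) : ∃ i : Fin m, t ∈ Ico (s i.castSucc) (s i.succ) := by
  by_contra! h
  have : ∀ i, s i ≤ t := fun i => by
    induction i using Fin.induction with
    | zero => exact h0 ▸ ht.1
    | succ i ih => exact not_lt.1 fun h' => h i ⟨ih, h'⟩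
  exact absurd ht.2 (not_lt.2 (h1 ▸ this (Fin.last m)))

theorem exists_piece_left {m : ℕ} {s : Fin (m + 1) → ℝ} (h0 : s 0 = 0) (h1 : s (Fin.last m) = 1)
    {t : ℝ} (ht : t ∈ Ioc (0 : ℝ) 1) : ∃ i : Fin m, t ∈ Ioc (s i.castSucc) (s i.succ) := by
  by_contra! h
  have : ∀ i, s i < t := fun i => by
    induction i using Fin.induction with
    | zero => exact h0 ▸ ht.1
    | succ i ih => exact not_le.1 fun h' => h i ⟨ih, h'⟩
  exact absurd ht.2 (not_le.2 (h1 ▸ this (Fin.last m)))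

theorem exists_hasDerivWithinAt_Ici (hγ : IsPiecewiseSmoothImmersion γ) {t : ℝ}
    (ht : t ∈ Ico (0 : ℝ) 1) : ∃ v ≠ 0, HasDerivWithinAt γ v (Ici t) t := by
  obtain ⟨m, s, -, h0, h1, hs⟩ := hγ.pieces
  obtain ⟨i, hi⟩ := exists_piece_right h0 h1 ht
  have hmem := Ico_subset_Icc_self hi
  refine ⟨_, (hs i).2 t hmem, ?_⟩
  have := (((hs i).1.differentiableOn (by simp)) t hmem).hasDerivWithinAt
  refine this.mono_of_mem_nhdsWithin ?_
  filter_upwards [Ico_mem_nhdsGE hi.2] with x hx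
  exact ⟨hi.1.trans hx.1, hx.2.le⟩

theorem exists_hasDerivWithinAt_Iic (hγ : IsPiecewiseSmoothImmersion γ) {t : ℝ}
    (ht : t ∈ Ioc (0 : ℝ) 1) : ∃ v ≠ 0, HasDerivWithinAt γ v (Iic t) t := by
  obtain ⟨m, s, -, h0, h1, hs⟩ := hγ.pieces
  obtain ⟨i, hi⟩ := exists_piece_left h0 h1 ht
  have hmem := Ioc_subset_Icc_self hi
  refine ⟨_, (hs i).2 t hmem, ?_⟩
  have := (((hs i).1.differentiableOn (by simp)) t hmem).hasDerivWithinAt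
  refine this.mono_of_mem_nhdsWithin ?_
  filter_upwards [Ioc_mem_nhdsLE hi.1] with x hx
  exact ⟨hx.1.le, hx.2.trans hi.2⟩

theorem exists_finite_hasDerivAt (hγ : IsPiecewiseSmoothImmersion γ) :
    ∃ F : Set ℝ, F.Finite ∧ ∀ t ∈ Ioo (0 : ℝ) 1, t ∉ F → ∃ v ≠ 0, HasDerivAt γ v t := by
  obtain ⟨m, s, -, h0, h1, hs⟩ := hγ.pieces
  refine ⟨range s, finite_range s, fun t ht htF => ?_⟩
  obtain ⟨i, hi⟩ := exists_piece_right h0 h1 ⟨ht.1.le, ht.2⟩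
  have hmem := Ico_subset_Icc_self hi
  refine ⟨_, (hs i).2 t hmem, ?_⟩
  refine (((hs i).1.differentiableOn (by simp)) t hmem).hasDerivWithinAt.hasDerivAt
    (Icc_mem_nhds (lt_of_le_of_ne hi.1 fun h => htF ⟨_, h⟩) hi.2)

theorem dimH_image_le (hγ : IsPiecewiseSmoothImmersion γ) : dimH (γ '' Icc 0 1) ≤ 1 := by
  obtain ⟨m, s, -, h0, h1, hs⟩ := hγ.pieces
  have hcover : γ '' Icc 0 1 ⊆
      (⋃ i : Fin m, γ '' Icc (s i.castSucc) (s i.succ)) ∪ {γ 1} := by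
    rintro _ ⟨t, ht, rfl⟩
    rcases eq_or_lt_of_le ht.2 with h | h
    · exact Or.inr (h ▸ rfl)
    · obtain ⟨i, hi⟩ := exists_piece_right h0 h1 ⟨ht.1, h⟩
      exact Or.inl (mem_iUnion.2 ⟨i, mem_image_of_mem _ (Ico_subset_Icc_self hi)⟩)
  refine (dimH_mono hcover).trans ?_
  rw [dimH_union, dimH_singleton, dimH_iUnion]
  refine max_le (iSup_le fun i => ?_) zero_le
  refine (((hs i).1.of_le (by simp)).dimH_image_le (convex_Icc _ _) subset_rfl).trans ?_
  exact (dimH_mono (subset_univ _)).trans (by rw [Real.dimH_univ])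

end IsPiecewiseSmoothImmersion

/-- Two curves with independent velocities at a common point do not meet again nearby. -/
theorem eventually_ne_of_linearIndependent {E : Type*} [NormedAddCommGroup E] [NormedSpace ℝ E]
    {f g : ℝ → E} {S T : Set ℝ}
    {t s : ℝ} {v w : E} (hf : HasDerivWithinAt f v S t) (hg : HasDerivWithinAt g w T s)
    (hvw : LinearIndependent ℝ ![v, w]) :
    ∀ᶠ q : ℝ × ℝ in 𝓝[(S ×ˢ T) \ {(t, s)}] (t, s), f q.1 ≠ g q.2 := by
  have hf' : HasFDerivWithinAt (fun q : ℝ × ℝ => f q.1) _ (S ×ˢ T) (t, s) :=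
    HasFDerivWithinAt.comp (g := f) (t, s) hf.hasFDerivWithinAt hasFDerivWithinAt_fst
      fun q hq => hq.1
  have hg' : HasFDerivWithinAt (fun q : ℝ × ℝ => g q.2) _ (S ×ˢ T) (t, s) :=
    HasFDerivWithinAt.comp (g := g) (t, s) hg.hasFDerivWithinAt hasFDerivWithinAt_snd
      fun q hq => hq.2
  -- The derivative `(x, y) ↦ x • v - y • w` of the difference is injective, hence bounded below.
  have h := (hf'.sub hg').eventually_ne (c := 0) ?_
  · filter_upwards [h] with q hq heq
    exact hq (sub_eq_zero.2 heq)
  · obtain ⟨K, -, hK⟩ := LinearMap.exists_antilipschitzWith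
      (((ContinuousLinearMap.toSpanSingleton ℝ v).comp (ContinuousLinearMap.fst ℝ ℝ ℝ) -
        (ContinuousLinearMap.toSpanSingleton ℝ w).comp (ContinuousLinearMap.snd ℝ ℝ ℝ) :
        ℝ × ℝ →L[ℝ] E) : ℝ × ℝ →ₗ[ℝ] E) (by
      rw [LinearMap.ker_eq_bot']
      rintro ⟨x, y⟩ hxy
      have hxy' : x • v + (-y) • w = 0 := by
        simpa [sub_eq_add_neg] using hxy
      obtain ⟨rfl, hy⟩ := LinearIndependent.pair_iff.1 hvw _ _ hxy'
      simp [neg_eq_zero.1 hy])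
    exact ⟨K, hK⟩

/-- A curve leaving a point of `F` in a direction not tangent to `F` does not return to `F` at
once. -/
theorem eventually_notMem_of_notMem_tangentCone {E : Type*} [NormedAddCommGroup E]
    [NormedSpace ℝ E] {γ : ℝ → E} {F : Set E} {t : ℝ} {v : E}
    (hγ : HasDerivWithinAt γ v (Ici t) t) (hv : v ∉ tangentConeAt ℝ F (γ t)) :
    ∀ᶠ x in 𝓝[>] t, γ x ∉ F := by
  by_contra h
  rw [Filter.not_eventually] at h
  simp only [not_not] at h
  set s : Set ℝ := {x | t < x ∧ γ x ∈ F}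
  -- If the return times accumulate at `t`, their tangent cone there is all of `ℝ`, and the
  -- derivative sends `1` to `v` in the cone of `F`.
  have hacc : AccPt t (Filter.principal s) := by
    rw [accPt_iff_frequently_nhdsNE]
    have h' : ∃ᶠ x in 𝓝[>] t, x ∈ s :=
      (h.and_eventually self_mem_nhdsWithin).mono fun x hx => ⟨hx.2, hx.1⟩
    exact h'.filter_mono (nhdsWithin_mono _ fun x hx => ne_of_gt hx)
  have hs : HasDerivWithinAt γ v s t := hγ.mono fun x hx => le_of_lt hx.1
  have h1 : (1 : ℝ) ∈ tangentConeAt ℝ s t := by rw [tangentConeAt_eq_univ hacc]; trivial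
  have h2 := hs.hasFDerivWithinAt.mapsTo_tangent_cone h1
  rw [ContinuousLinearMap.toSpanSingleton_apply, one_smul] at h2
  have hsub : γ '' s ⊆ F := image_subset_iff.2 fun x hx => hx.2
  exact hv (tangentConeAt_mono hsub h2)

/-! ### Transversality, first returns and thinness of the lines -/

namespace Cuts

variable {n : ℕ} {Ω : Set Plane} {γ : Fin n → ℝ → Plane}

/-- Compactness of `[0, 1]` reduces this to times near a fixed `s`. There continuity separates the
lines if `γ j s ≠ γ i t`; otherwise transversality does, on each side of `s`. -/
theorem eventually_avoids (hγ : Cuts Ω γ) (hΩ : IsOpen Ω) {i j : Fin n} (hij : i ≠ j) {t : ℝ}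
    (ht : t ∈ Ioo (0 : ℝ) 1) (htΩ : γ i t ∈ Ω) :
    ∀ᶠ x in 𝓝[>] t, ∀ s ∈ Icc (0 : ℝ) 1, γ j s ≠ γ i x := by
  have hfr : ∀ p ∈ frontier Ω, p ∉ Ω := fun p hp hp' => by
    rw [hΩ.frontier_eq] at hp; exact hp.2 hp'
  have hit : ContinuousAt (γ i) t :=
    (hγ.immersed i).continuousOn.continuousAt (Icc_mem_nhds ht.1 ht.2)
  refine isCompact_Icc.induction_on (p := fun A => ∀ᶠ x in 𝓝[>] t, ∀ s ∈ A, γ j s ≠ γ i x)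
    (by simp) (fun A B hAB h => h.mono fun x hx s hs => hx s (hAB hs))
    (fun A B hA hB => by
      filter_upwards [hA, hB] with x hxA hxB s hs
      exact hs.elim (hxA s) (hxB s)) fun s hs => ?_
  suffices h : ∀ᶠ q : ℝ × ℝ in 𝓝[>] t ×ˢ 𝓝[Icc 0 1] s, γ j q.2 ≠ γ i q.1 by
    obtain ⟨P, hP, Q, hQ, hPQ⟩ := Filter.eventually_prod_iff.1 h
    exact ⟨{x | Q x}, hQ, hP.mono fun x hx s hs => hPQ hx hs⟩
  by_cases he : γ i t = γ j s
  · have hjs : γ j s ∈ Ω := he ▸ htΩ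
    have hs0 : 0 < s := lt_of_le_of_ne hs.1 fun h => hfr _ (hγ.start_mem j) (h ▸ hjs)
    have hs1 : s < 1 := lt_of_le_of_ne hs.2 fun h => hfr _ (hγ.finish_mem j) (h ▸ hjs)
    obtain ⟨v, -, hv⟩ := (hγ.immersed i).exists_hasDerivWithinAt_Ici ⟨ht.1.le, ht.2⟩
    have key : ∀ (T : Set ℝ) (w : Plane), s ∈ T → HasDerivWithinAt (γ j) w T s →
        w ∈ tangents (γ j) s → ∀ᶠ q : ℝ × ℝ in 𝓝[>] t ×ˢ 𝓝[T] s, γ j q.2 ≠ γ i q.1 := by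
      intro T w hsT hw hwt
      have := eventually_ne_of_linearIndependent hv hw
        (hγ.transversal i j hij t ⟨ht.1.le, ht.2.le⟩ s hs he htΩ v (Or.inl ⟨ht.2, hv⟩) w hwt)
      rw [← nhdsWithin_prod_eq]
      refine (this.filter_mono (nhdsWithin_mono _ ?_)).mono fun q hq => hq.symm
      exact fun q hq => ⟨⟨le_of_lt (mem_Ioi.1 hq.1), hq.2⟩,
        fun h => (ne_of_gt (mem_Ioi.1 hq.1)) (congrArg Prod.fst h)⟩
    obtain ⟨w, -, hw⟩ := (hγ.immersed j).exists_hasDerivWithinAt_Ici ⟨hs0.le, hs1⟩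
    obtain ⟨w', -, hw'⟩ := (hγ.immersed j).exists_hasDerivWithinAt_Iic ⟨hs0, hs1.le⟩
    have h1 := key _ w self_mem_Ici hw (Or.inl ⟨hs1, hw⟩)
    have h2 := key _ w' self_mem_Iic hw' (Or.inr ⟨hs0, hw'⟩)
    refine (Filter.eventually_sup.2 ⟨h2, h1⟩).filter_mono ?_
    rw [← Filter.prod_sup, nhdsLE_sup_nhdsGE]
    exact Filter.prod_mono le_rfl nhdsWithin_le_nhds
  · have hjs : Filter.Tendsto (fun q : ℝ × ℝ => γ j q.2) (𝓝[>] t ×ˢ 𝓝[Icc 0 1] s)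
        (𝓝 (γ j s)) := ((hγ.immersed j).continuousOn s hs).tendsto.comp Filter.tendsto_snd
    have hit' : Filter.Tendsto (fun q : ℝ × ℝ => γ i q.1) (𝓝[>] t ×ˢ 𝓝[Icc 0 1] s)
        (𝓝 (γ i t)) := (hit.tendsto.mono_left nhdsWithin_le_nhds).comp Filter.tendsto_fst
    exact ((hjs.sub hit').eventually_ne (sub_ne_zero.2 (Ne.symm he))).mono
      fun q hq => sub_ne_zero.1 hq

/-- Each line enters the region and runs inside it up to a first return to the boundary. -/
theorem exists_first_return (hγ : Cuts Ω γ) (hΩ : IsOpen Ω) (i : Fin n) :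
    ∃ l ∈ Ioc (0 : ℝ) 1, γ i l ∈ frontier Ω ∧ ∀ t ∈ Ioo 0 l, γ i t ∈ Ω := by
  obtain ⟨v, -, hv⟩ := (hγ.immersed i).exists_hasDerivWithinAt_Ici ⟨le_rfl, one_pos⟩
  have hev := eventually_notMem_of_notMem_tangentCone hv
    (hγ.start_transversal i v (Or.inl ⟨one_pos, hv⟩))
  obtain ⟨δ, hδ, hδ'⟩ := (mem_nhdsGT_iff_exists_Ioo_subset' one_pos).1 hev
  -- Capping at `1` keeps the finishing time in the compact set `A` of returns.
  have hδ0 : 0 < min δ 1 := lt_min hδ one_pos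
  set A : Set ℝ := Icc (min δ 1) 1 ∩ γ i ⁻¹' frontier Ω with hA
  have hAc : IsCompact A := by
    refine isCompact_Icc.of_isClosed_subset ?_ inter_subset_left
    exact ((hγ.immersed i).continuousOn.mono (Icc_subset_Icc_left hδ0.le)
      ).preimage_isClosed_of_isClosed isClosed_Icc isClosed_frontier
  obtain ⟨l, hl, hmin⟩ := hAc.exists_isLeast ⟨1, ⟨min_le_right _ _, le_rfl⟩, hγ.finish_mem i⟩
  refine ⟨l, ⟨hδ0.trans_le hl.1.1, hl.1.2⟩, hl.2, fun t ht => ?_⟩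
  have hcl := hγ.mem_closure i t ⟨ht.1.le, ht.2.le.trans hl.1.2⟩
  by_contra htΩ
  have hfr : γ i t ∈ frontier Ω := by rw [hΩ.frontier_eq]; exact ⟨hcl, htΩ⟩
  rcases lt_or_ge t (min δ 1) with h | h
  · exact hδ' ⟨ht.1, h.trans_le (min_le_left _ _)⟩ hfr
  · exact absurd (hmin ⟨⟨h, ht.2.le.trans hl.1.2⟩, hfr⟩) (not_le.2 ht.2)

theorem dense_compl (hγ : Cuts Ω γ) : Dense (⋃ j, γ j '' Icc 0 1)ᶜ := by
  refine dense_compl_of_dimH_lt_finrank ?_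
  rw [dimH_iUnion, finrank_euclideanSpace_fin]
  exact (iSup_le fun j => (hγ.immersed j).dimH_image_le).trans_lt (by norm_num)

/-- No part of the lines separates the region. -/
theorem isPreconnected_diff (hγ : Cuts Ω γ) (hΩ : IsOpen Ω) {N : Set Plane}
    (hN : N ⊆ ⋃ j, γ j '' Icc 0 1) : IsPreconnected (Ω \ N) :=
  -- By density, `Ω \ N` lies between the connected complement of all lines in `Ω` and its closure.
  hγ.isConnected_compl.isPreconnected.subset_closure (sdiff_subset_sdiff_right hN)
    (sdiff_subset.trans (hγ.dense_compl.open_subset_closure_inter hΩ))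

end Cuts

/-! ### Holes -/

theorem IsClosed.isClosed_connectedComponentIn {X : Type*} [TopologicalSpace X] {F : Set X}
    (hF : IsClosed F) (x : X) : IsClosed (connectedComponentIn F x) := by
  by_cases hx : x ∈ F
  · refine isClosed_of_closure_subset (isPreconnected_connectedComponentIn.closure
      |>.subset_connectedComponentIn (subset_closure (mem_connectedComponentIn hx)) ?_)
    exact closure_minimal (connectedComponentIn_subset F x) hF
  · rw [connectedComponentIn_eq_empty hx]
    exact isClosed_empty

/-- Polar coordinates: a ray times the unit sphere, which is connected in dimension above one. -/
theorem isPreconnected_setOf_lt_norm {E : Type*} [NormedAddCommGroup E] [NormedSpace ℝ E]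
    (h : 1 < Module.rank ℝ E) {R : ℝ} (hR : 0 ≤ R) : IsPreconnected {x : E | R < ‖x‖} := by
  have himg : {x : E | R < ‖x‖} =
      (fun q : ℝ × E => q.1 • q.2) '' (Ioi R ×ˢ Metric.sphere (0 : E) 1) := by
    ext x
    constructor
    · intro hx
      have hx0 : ‖x‖ ≠ 0 := (hR.trans_lt hx).ne'
      exact ⟨(‖x‖, ‖x‖⁻¹ • x), ⟨hx, by simp [norm_smul, hx0]⟩, by simp [smul_smul, hx0]⟩
    · rintro ⟨⟨t, y⟩, ⟨ht, hy⟩, rfl⟩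
      rw [mem_sphere_zero_iff_norm] at hy
      simpa [norm_smul, hy, abs_of_pos (hR.trans_lt ht)] using ht
  rw [himg]
  exact (isPreconnected_Ioi.prod (isPreconnected_sphere h 0 1)).image _ (by fun_prop)

/-- The complement of a bounded planar set has at most one unbounded component. -/
theorem connectedComponentIn_compl_eq_of_not_isBounded {Ω : Set Plane}
    (hΩ : Bornology.IsBounded Ω) {x y : Plane}
    (hx : ¬ Bornology.IsBounded (connectedComponentIn Ωᶜ x))
    (hy : ¬ Bornology.IsBounded (connectedComponentIn Ωᶜ y)) :
    connectedComponentIn Ωᶜ x = connectedComponentIn Ωᶜ y := by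
  obtain ⟨R, hR⟩ := hΩ.subset_closedBall 0
  have hsub : {z : Plane | max R 0 < ‖z‖} ⊆ Ωᶜ := fun z hz hzΩ =>
    absurd (mem_closedBall_zero_iff.1 (hR hzΩ)) (not_le.2 ((le_max_left _ _).trans_lt hz))
  have hpre : IsPreconnected {z : Plane | max R 0 < ‖z‖} := by
    refine isPreconnected_setOf_lt_norm ?_ (le_max_right _ _)
    rw [← Module.finrank_eq_rank, finrank_euclideanSpace_fin]
    norm_num
  have hfar : ∀ x, ¬ Bornology.IsBounded (connectedComponentIn Ωᶜ x) →
      ∃ z ∈ connectedComponentIn Ωᶜ x, max R 0 < ‖z‖ := by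
    intro x hx
    by_contra! h
    exact hx ((Metric.isBounded_closedBall (x := (0 : Plane)) (r := max R 0)).subset
      fun z hz => mem_closedBall_zero_iff.2 (h z hz))
  obtain ⟨z, hz, hzR⟩ := hfar x hx
  obtain ⟨z', hz', hzR'⟩ := hfar y hy
  rw [connectedComponentIn_eq hz, connectedComponentIn_eq hz']
  exact connectedComponentIn_eq (hpre.subset_connectedComponentIn hzR hsub hzR')

namespace IsRegionWithHoles

variable {Ω : Set Plane} {k : ℕ}

/-- A region with `k` holes has at most `k + 1` complementary components. -/
theorem encard_components_le (hΩ : IsRegionWithHoles Ω k) :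
    {C | ∃ x ∈ Ωᶜ, C = connectedComponentIn Ωᶜ x}.encard ≤ k + 1 := by
  set V : Set (Set Plane) := {C | ∃ x ∈ Ωᶜ, C = connectedComponentIn Ωᶜ x}
  have hsub : V ⊆ holes Ω ∪ {C ∈ V | ¬ Bornology.IsBounded C} := fun C hC =>
    (em (Bornology.IsBounded C)).imp (fun h => ⟨h, hC⟩) fun h => ⟨hC, h⟩
  refine (encard_le_encard hsub).trans ((encard_union_le _ _).trans ?_)
  rw [hΩ.encard_holes]
  gcongr
  rw [encard_le_one_iff]
  rintro _ _ ⟨⟨x, -, rfl⟩, hx⟩ ⟨⟨y, -, rfl⟩, hy⟩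
  exact connectedComponentIn_compl_eq_of_not_isBounded hΩ.isBounded hx hy

theorem notMem_of_mem_frontier (hΩ : IsRegionWithHoles Ω k) {p : Plane} (hp : p ∈ frontier Ω) :
    p ∈ Ωᶜ := by
  rw [hΩ.isOpen.frontier_eq] at hp
  exact hp.2

/-- Each hole is met by a line, and each line meets at most two holes. -/
theorem le_two_mul (hΩ : IsRegionWithHoles Ω k) {n : ℕ} {γ : Fin n → ℝ → Plane}
    (hγ : Cuts Ω γ) : k ≤ 2 * n := by
  have hsub : holes Ω ⊆ range fun q : Fin n × Bool =>
      connectedComponentIn Ωᶜ (γ q.1 (if q.2 then 1 else 0)) := by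
    intro C hC
    have hne : {j | γ j 0 ∈ frontier C ∨ γ j 1 ∈ frontier C}.Nonempty := by
      by_contra h
      have := hγ.odd_lines C hC
      rw [not_nonempty_iff_eq_empty.1 h, ncard_empty] at this
      exact absurd this (by decide)
    obtain ⟨-, x, -, rfl⟩ := hC
    have hcl := hΩ.isOpen.isClosed_compl.isClosed_connectedComponentIn x
    obtain ⟨j, hj | hj⟩ := hne
    · exact ⟨(j, false), by simpa using (connectedComponentIn_eq (hcl.frontier_subset hj)).symm⟩
    · exact ⟨(j, true), by simpa using (connectedComponentIn_eq (hcl.frontier_subset hj)).symm⟩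
  have h := (encard_le_encard hsub).trans ((congrArg encard image_univ).symm.le.trans
    ((encard_image_le _ _).trans encard_le_card))
  rw [hΩ.encard_holes, ENat.card_eq_coe_fintype_card, Fintype.card_prod, Fintype.card_fin,
    Fintype.card_bool, mul_comm] at h
  exact_mod_cast h

end IsRegionWithHoles

/-! ### The upper bound: lines as simple arcs between complementary components -/

namespace Cuts

variable {n : ℕ} {Ω : Set Plane} {γ : Fin n → ℝ → Plane}

/-- Each line has, right after its start, a regular point through which no other line passes. -/
theorem exists_regular (hγ : Cuts Ω γ) (hΩ : IsOpen Ω) (i : Fin n) {l : ℝ} (hl : l ∈ Ioc (0 : ℝ) 1)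
    (hin : ∀ t ∈ Ioo 0 l, γ i t ∈ Ω) :
    ∃ τ ∈ Ioo 0 l, (∃ v ≠ 0, HasDerivAt (γ i) v τ) ∧
      ∀ j ≠ i, ∀ x ∈ Icc (0 : ℝ) 1, γ j x ≠ γ i τ := by
  obtain ⟨F, hF, hreg⟩ := (hγ.immersed i).exists_finite_hasDerivAt
  have hm : l / 2 ∈ Ioo 0 l := ⟨half_pos hl.1, half_lt_self hl.1⟩
  have hav : ∀ᶠ τ in 𝓝[>] (l / 2), ∀ j ≠ i, ∀ x ∈ Icc (0 : ℝ) 1, γ j x ≠ γ i τ := by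
    rw [Filter.eventually_all]
    intro j
    by_cases hji : j = i
    · simp [hji]
    · filter_upwards [hγ.eventually_avoids hΩ (Ne.symm hji) ⟨hm.1, hm.2.trans_le hl.2⟩
        (hin _ hm)] with τ hτ _ using hτ
  have hFev : ∀ᶠ τ in 𝓝[>] (l / 2), τ ∉ F := by
    -- The time `l / 2` may itself be a corner; only later times are used.
    have h : (F \ {l / 2})ᶜ ∈ 𝓝 (l / 2) :=
      (hF.subset sdiff_subset).isClosed.isOpen_compl.mem_nhds (by simp)
    filter_upwards [nhdsWithin_le_nhds h, self_mem_nhdsWithin] with τ hτ hτl hτF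
    exact hτ ⟨hτF, ne_of_gt hτl⟩
  obtain ⟨τ, ⟨hτ, hτF⟩, hτI⟩ := ((hav.and hFev).and (Ioo_mem_nhdsGT hm.2)).exists
  have hτ0 : 0 < τ := hm.1.trans hτI.1
  exact ⟨τ, ⟨hτ0, hτI.2⟩, hreg τ ⟨hτ0, hτI.2.trans_le hl.2⟩ hτF, hτ⟩

/-- As long as it stays inside the region, a line does not meet itself: otherwise it would contain
a loop, which separates the region. -/
theorem injOn_Ioo (hγ : Cuts Ω γ) (hΩ : IsOpen Ω) (i : Fin n) {l : ℝ} (hl : l ∈ Ioc (0 : ℝ) 1)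
    (hin : ∀ t ∈ Ioo 0 l, γ i t ∈ Ω) : InjOn (γ i) (Ioo 0 l) := by
  have hlt : ∀ s ∈ Ioo 0 l, ∀ t ∈ Ioo 0 l, s < t → γ i s ≠ γ i t := by
    intro s hs t ht hst he
    have hsub : Icc s t ⊆ Icc 0 1 := Icc_subset_Icc hs.1.le (ht.2.le.trans hl.2)
    obtain ⟨u, v, hsu, huv, hvt, hloop, hsimple⟩ := exists_simple_loop hst
      ((hγ.immersed i).continuousOn.mono hsub) he fun x hx => by
        obtain ⟨V, hV, hVi⟩ := (hγ.immersed i).locallyInjective x (hsub hx)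
        exact ⟨V, hV, hVi.mono (inter_subset_inter_right V hsub)⟩
    have huvI : Icc u v ⊆ Icc 0 1 := (Icc_subset_Icc hsu hvt).trans hsub
    obtain ⟨F, hF, hreg⟩ := (hγ.immersed i).exists_finite_hasDerivAt
    -- A smooth point other than the base point of the simple loop is passed exactly once.
    obtain ⟨τ, hτ, hτF⟩ := ((Ioo_infinite huv).sdiff hF).nonempty
    obtain ⟨w, hw, hd⟩ := hreg τ
      ⟨(hs.1.trans_le hsu).trans hτ.1, hτ.2.trans_le (hvt.trans (ht.2.le.trans hl.2))⟩ hτF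
    set e : Plane ≃ₗᵢ[ℝ] ℂ := Complex.orthonormalBasisOneI.repr.symm
    have hinj : ∀ x ∈ Icc u v, e (γ i x) = e (γ i τ) → x = τ := by
      intro x hx hxe
      have hτI := Ioo_subset_Icc_self hτ
      rcases lt_trichotomy x τ with h | h | h
      · exact absurd (hsimple x hx τ hτI h (e.injective hxe)).2 hτ.2.ne
      · exact h
      · exact absurd (hsimple τ hτI x hx h (e.injective hxe).symm).1 hτ.1.ne'
    refine not_isPreconnected_diff_loop (α := fun x => e (γ i x)) (Ω := e '' Ω) (w := e w)
      (e.toHomeomorph.isOpenMap Ω hΩ)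
      (e.continuous.comp_continuousOn ((hγ.immersed i).continuousOn.mono huvI))
      (fun x hx => mem_image_of_mem _
        (hin x ⟨hs.1.trans_le (hsu.trans hx.1), (hx.2.trans hvt).trans_lt ht.2⟩))
      hτ.1 hτ.2 (e.toContinuousLinearEquiv.hasFDerivAt.comp_hasDerivAt τ hd)
      (by simpa using hw) hinj (congrArg e hloop) ?_
    rw [← image_image e (γ i), ← image_sdiff e.injective]
    refine (hγ.isPreconnected_diff hΩ ?_).image _ e.continuous.continuousOn
    exact (image_mono huvI).trans (subset_iUnion (fun j => γ j '' Icc 0 1) i)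
  intro s hs t ht he
  rcases lt_trichotomy s t with h | h | h
  · exact absurd he (hlt s hs t ht h)
  · exact h
  · exact absurd he.symm (hlt t ht s hs h)

end Cuts

/-- Lines cutting a region with `k` holes are at most `k` in number. -/
theorem IsRegionWithHoles.card_le {Ω : Set Plane} {k n : ℕ} (hΩ : IsRegionWithHoles Ω k)
    {γ : Fin n → ℝ → Plane} (hγ : Cuts Ω γ) : n ≤ k := by
  -- For `n > 0`, the start of a line shows that the vertex set is nonempty.
  rcases n.eq_zero_or_pos with rfl | hn
  · exact Nat.zero_le k
  choose l hl hlf hin using hγ.exists_first_return hΩ.isOpen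
  set V : Set (Set Plane) := {C | ∃ x ∈ Ωᶜ, C = connectedComponentIn Ωᶜ x} with hV
  have hVfin : V.Finite := finite_of_encard_le_coe (k := k + 1)
    (by exact_mod_cast hΩ.encard_components_le)
  have : Fintype V := hVfin.fintype
  have hs : ∀ i, connectedComponentIn Ωᶜ (γ i 0) ∈ V := fun i =>
    ⟨_, hΩ.notMem_of_mem_frontier (hγ.start_mem i), rfl⟩
  have ht : ∀ i, connectedComponentIn Ωᶜ (γ i (l i)) ∈ V := fun i =>
    ⟨_, hΩ.notMem_of_mem_frontier (hlf i), rfl⟩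
  have : Nonempty V := ⟨⟨_, hs ⟨0, hn⟩⟩⟩
  set e : Plane ≃ₗᵢ[ℝ] ℂ := Complex.orthonormalBasisOneI.repr.symm
  have hI : ∀ i, Icc 0 (l i) ⊆ Icc (0 : ℝ) 1 := fun i => Icc_subset_Icc_right (hl i).2
  have hcard := card_arcs_lt_card_of_isPreconnected_diff (Ω := e '' Ω) (V := V)
    (e.toHomeomorph.isOpenMap Ω hΩ.isOpen) (fun C => e '' (C : Set Plane))
    (by
      rintro ⟨_, x, -, rfl⟩
      exact isPreconnected_connectedComponentIn.image _ e.continuous.continuousOn)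
    (by
      rintro ⟨_, x, -, rfl⟩
      rw [← image_compl_eq e.bijective]
      exact image_mono (connectedComponentIn_subset _ _))
    (fun i x => e (γ i x)) l
    (fun i => e.continuous.comp_continuousOn ((hγ.immersed i).continuousOn.mono (hI i)))
    (fun i => ⟨_, hs i⟩) (fun i => ⟨_, ht i⟩)
    (fun i => mem_image_of_mem _ (mem_connectedComponentIn
      (hΩ.notMem_of_mem_frontier (hγ.start_mem i))))
    (fun i => mem_image_of_mem _ (mem_connectedComponentIn (hΩ.notMem_of_mem_frontier (hlf i))))
    (fun i x hx => mem_image_of_mem _ (hin i x hx))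
    (fun i => e.injective.comp_injOn (hγ.injOn_Ioo hΩ.isOpen i (hl i) (hin i)))
    (fun i => by
      obtain ⟨τ, hτ, ⟨v, hv, hd⟩, hav⟩ := hγ.exists_regular hΩ.isOpen i (hl i) (hin i)
      exact ⟨τ, hτ, ⟨e v, by simpa using hv,
        e.toContinuousLinearEquiv.hasFDerivAt.comp_hasDerivAt τ hd⟩,
        fun j hj x hx h => hav j hj x (hI j hx) (e.injective h)⟩)
    (by
      rw [iUnion_congr fun i => (image_image e (γ i) (Icc 0 (l i))).symm, ← image_iUnion,
        ← image_sdiff e.injective]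
      exact (hγ.isPreconnected_diff hΩ.isOpen (iUnion_mono fun i => image_mono (hI i))).image _
        e.continuous.continuousOn)
  have hle := hΩ.encard_components_le
  rw [← hV, encard_eq_coe_toFinset_card, toFinset_card] at hle
  have : Fintype.card V ≤ k + 1 := by exact_mod_cast hle
  omega

theorem mainTheorem5 (k n : ℕ) (Ω : Set Plane) (hΩ : IsRegionWithHoles Ω k)
    (γ : Fin n → ℝ → Plane) (hγ : Cuts Ω γ) :
    (k : ℝ) / 2 ≤ (n : ℝ) ∧ n ≤ k := by
  refine ⟨?_, hΩ.card_le hγ⟩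
  have h : (k : ℝ) ≤ 2 * n := by exact_mod_cast hΩ.le_two_mul hγ
  linarith
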